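/- An influence graph $G=(V,E,p)$ consists of a finite node set $V$, a set $E\subseteq V\times V$ of directed edges and probabilities $p_{uv}\in[0,1]$ for $(u,v)\in E$. A random set $L\subseteq E$ of live edges contains each edge $(u,v)\in E$ independently with probability $p_{uv}$; the edges of $E\setminus L$ are called blocked. For $S\subseteq V$ let $\Gamma(S,L)$ be the set of nodes reachable from $S$ along edges of $L$ (including $S$ itself), let $\sigma(S)=\mathbb E_L\,|\Gamma(S,L)|$, and let $$\mathrm{OPT}_N(G,k)=\max_{S\subseteq V,\ |S|\le k}\sigma(S).$$ An adaptive policy $\pi$ selects seeds one at a time. After selecting $u$ it observes the full-adoption feedback of $u$, that is, the status (live or blocked) of every edge of $E$ leaving a node of $\Gamma(\{u\},L)$. From the collection of all pairs (selected seed, its feedback) observed so far, $\pi$ deterministically chooses the next seed or stops. Let $V(\pi,L)$ be the set of all seeds selected by $\pi$ when $L$ is the set of live edges, let $\sigma(\pi)=\mathbb E_L\,|\Gamma(V(\pi,L),L)|$, and let $\mathrm{OPT}_A(G,k)$ be the maximum of $\sigma(\pi)$ over all policies $\pi$ with $|V(\pi,L)|\le k$ for every $L\subseteq E$. An influence graph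 is an in-arborescence if $(V,E)$ is a directed tree (without loops or pairs of opposite edges) with a root $r\in V$ such that for every $v\in V$ the unique path between $v$ and $r$ is directed from $v$ to $r$. **Theorem.** For influence maximization in the independent cascade model with full-adoption feedback, the adaptivity gap on in-arborescences is at most $\frac{2e}{e-1}$: $$\sup_{G,\,k}\ \frac{\mathrm{OPT}_A(G,k)}{\mathrm{OPT}_N(G,k)}\ \le\ \frac{2e}{e-1},$$ where the supremum is over all in-arborescences $G$ and all integers $k\ge 1$. -/

import Mathlib

open scoped ENNReal

universe u

/-- A directed influence graph on the node set `V`: a finite set of directed edges `(u, v)`,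
each of which carries a probability. -/
structure InfluenceGraph (V : Type u) where
  edges : Finset (V × V)
  prob : V × V → ℝ
  prob_mem : ∀ e ∈ edges, prob e ∈ Set.Icc (0 : ℝ) 1

/-- What is seen after seeding a node: for every pair of nodes, `some true` means that it is an
edge observed to be live, `some false` that it is an edge observed to be blocked, and `none` that
nothing is observed. -/
abbrev Feedback (V : Type u) : Type u := V × V → Option Bool

/-- The collection of pairs (seed, feedback obtained from that seed) observed so far. -/
abbrev PartialRealization (V : Type u) : Type u := Set (V × Feedback V)

/-- The next seed as a function of the observations so far; `none` means that the policy stops. -/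
abbrev AdaptivePolicy (V : Type u) : Type u := PartialRealization V → Option V

/-- The nodes selected so far. -/
def PartialRealization.dom {V : Type u} (ψ : PartialRealization V) : Set V :=
  {v | ∃ o, (v, o) ∈ ψ}

namespace InfluenceGraph

noncomputable section

open scoped Classical in
/-- The probability that the live edges are exactly those in `L` (for `L ⊆ G.edges`): every edge
is live independently with its own probability. -/
def liveProb {V : Type u} (G : InfluenceGraph V) (L : Finset (V × V)) : ℝ :=
  ∏ e ∈ G.edges, if e ∈ L then G.prob e else 1 - G.prob e

/-- Expectation of `g` over the random live-edge graph. -/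
def expect {V : Type u} (G : InfluenceGraph V) (g : Finset (V × V) → ℝ) : ℝ :=
  ∑ L ∈ G.edges.powerset, G.liveProb L * g L

open scoped Classical in
/-- `Γ(S, L)`: the nodes reachable from `S` along live edges. -/
def reach {V : Type u} [Fintype V] (S : Finset V) (L : Finset (V × V)) : Finset V :=
  Finset.univ.filter fun v =>
    ∃ s ∈ S, Relation.ReflTransGen (fun a b => (a, b) ∈ L) s v

/-- The influence spread `σ(S)`. -/
def spread {V : Type u} [Fintype V] (G : InfluenceGraph V) (S : Finset V) : ℝ :=
  G.expect fun L => ((reach S L).card : ℝ)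

/-- The largest influence spread of a seed set of size at most `k`. -/
def optN {V : Type u} [Fintype V] (G : InfluenceGraph V) (k : ℕ) : ℝ :=
  ⨆ S : {S : Finset V // S.card ≤ k}, G.spread S

open scoped Classical in
/-- Full-adoption feedback of the node `v` when `L` is the set of live edges: the status of all
edges of `G` going out of nodes that are reachable from `v` along live edges. -/
def feedback {V : Type u} [Fintype V] (G : InfluenceGraph V) (L : Finset (V × V)) (v : V) :
    Feedback V :=
  fun e => if e ∈ G.edges ∧ e.1 ∈ reach {v} L then some (decide (e ∈ L)) else none

/-- The observations after `t` steps of the policy `π` when `L` is the set of live edges. -/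
def observe {V : Type u} [Fintype V] (G : InfluenceGraph V) (π : AdaptivePolicy V)
    (L : Finset (V × V)) : ℕ → PartialRealization V
  | 0 => ∅
  | t + 1 =>
    match π (observe G π L t) with
    | none => observe G π L t
    | some v => insert (v, G.feedback L v) (observe G π L t)

open scoped Classical in
/-- `V(π, φ)`: the nodes that `π` ever selects when `L` is the set of live edges. -/
def seeds {V : Type u} [Fintype V] (G : InfluenceGraph V) (π : AdaptivePolicy V)
    (L : Finset (V × V)) : Finset V :=
  Finset.univ.filter fun v => ∃ t, v ∈ (G.observe π L t).dom

/-- The adaptive influence spread `σ(π)`. -/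
def adaptiveSpread {V : Type u} [Fintype V] (G : InfluenceGraph V) (π : AdaptivePolicy V) : ℝ :=
  G.expect fun L => ((reach (G.seeds π L) L).card : ℝ)

/-- `π ∈ Π(k)`: the policy selects at most `k` seeds, whatever the live-edge graph is. -/
def IsFeasible {V : Type u} [Fintype V] (G : InfluenceGraph V) (k : ℕ) (π : AdaptivePolicy V) :
    Prop :=
  ∀ L ⊆ G.edges, (G.seeds π L).card ≤ k

/-- The largest adaptive influence spread of a policy that selects at most `k` seeds. -/
def optA {V : Type u} [Fintype V] (G : InfluenceGraph V) (k : ℕ) : ℝ :=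
  ⨆ π : {π : AdaptivePolicy V // G.IsFeasible k π}, G.adaptiveSpread π

/-- The undirected graph obtained by forgetting the directions of the edges. -/
def underlying {V : Type u} (G : InfluenceGraph V) : SimpleGraph V :=
  SimpleGraph.fromRel fun a b => (a, b) ∈ G.edges

/-- The influence graph is a directed tree (no loops, no pair of opposite edges, and the
underlying undirected graph is a tree) with a root `r` such that, for every node `v`, the path
from `v` to `r` in the tree is directed from `v` to `r`. -/
def IsInArborescence {V : Type u} (G : InfluenceGraph V) : Prop :=
  (∀ a b, (a, b) ∈ G.edges → (b, a) ∉ G.edges) ∧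
  G.underlying.IsTree ∧
  ∃ r : V, ∀ (v : V) (q : G.underlying.Walk v r), q.IsPath →
    ∀ d ∈ q.darts, (d.fst, d.snd) ∈ G.edges

/-- The adaptivity gap on a class `C` of influence graphs: the supremum over all finite influence
graphs in `C` and all budgets `k ≥ 1` of the ratio of the adaptive to the non-adaptive optimum. -/
def adaptivityGap (C : ∀ V : Type u, InfluenceGraph V → Prop) : ℝ≥0∞ :=
  ⨆ (V : Type u) (_ : Fintype V) (G : InfluenceGraph V) (_ : C V G) (k : ℕ) (_ : 1 ≤ k),
    ENNReal.ofReal (G.optA k) / ENNReal.ofReal (G.optN k)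

end

/-- The supremum in `optN` is a maximum. -/
theorem optN_isGreatest {V : Type u} [Fintype V] (G : InfluenceGraph V) (k : ℕ) :
    IsGreatest {x | ∃ S : Finset V, S.card ≤ k ∧ G.spread S = x} (G.optN k) := by
  have : Nonempty {S : Finset V // S.card ≤ k} := ⟨⟨∅, by simp⟩⟩
  refine ⟨?_, ?_⟩
  · obtain ⟨S, hS⟩ := exists_eq_ciSup_of_finite
      (f := fun S : {S : Finset V // S.card ≤ k} => G.spread S)
    exact ⟨S, S.2, hS⟩
  · rintro x ⟨S, hS, rfl⟩
    exact le_ciSup (f := fun S : {S : Finset V // S.card ≤ k} => G.spread S)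
      (Set.finite_range _).bddAbove ⟨S, hS⟩

/-- The supremum in `optA` is a maximum. -/
theorem optA_isGreatest {V : Type u} [Fintype V] (G : InfluenceGraph V) (k : ℕ) :
    IsGreatest {x | ∃ π : AdaptivePolicy V, G.IsFeasible k π ∧ G.adaptiveSpread π = x}
      (G.optA k) := by
  have h : ∀ (L : Finset (V × V)) (t : ℕ), G.observe (fun _ => none) L t = ∅ := by
    intro L t
    induction t with
    | zero => rfl
    | succ t ih => simpa [observe] using ih
  have : Nonempty {π : AdaptivePolicy V // G.IsFeasible k π} :=
    ⟨⟨fun _ => none, fun L _ => by simp [seeds, h, PartialRealization.dom]⟩⟩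
  refine ⟨?_, ?_⟩
  · obtain ⟨π, hπ⟩ := exists_eq_ciSup_of_finite
      (f := fun π : {π : AdaptivePolicy V // G.IsFeasible k π} => G.adaptiveSpread π)
    exact ⟨π, π.2, hπ⟩
  · rintro x ⟨π, hπ, rfl⟩
    exact le_ciSup (f := fun π : {π : AdaptivePolicy V // G.IsFeasible k π} => G.adaptiveSpread π)
      (Set.finite_range _).bddAbove ⟨π, hπ⟩

end InfluenceGraph

/-!
Fix a policy `π` with at most `k` seeds, and let `x v` be the probability that `π` selects `v`.
The heart of the proof is the inequality

  `σ(π) ≤ σ(S) + OPT_N + ∑ v, x v * (σ(S ∪ {v}) - σ(S))`   for every `S` with `|S| ≤ k`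

(`adaptiveSpread_le`). To prove it, run `π` on a live-edge graph `L` and let `S` spread in an
independent copy `L'`, reaching the set `T`. Let `y ∉ T` be reached by `π`, and let `v` be the
first seed of `π` from which `y` is reached.

* If the path from `v` to `y` meets `T`, then its last node in `T` has no out-edge in `L'`, because
  every node has at most one out-edge in an in-arborescence. There are at most `|S|` such ends of
  cascades (`card_cascadeEnds_le`), and they are independent of `L`, so what they reach in `L` has
  expected size at most `OPT_N`.
* Otherwise `T` avoids the path from `v` to `y`. As `v` is the first seed to reach `y`, nothing has
  been observed on that path when `v` is selected; so the selection of `v` depends only on edges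
  off the path, and it is independent of the path being live. The event that `T` avoids the path
  depends only on edges off the path too. The case thus contributes at most
  `x v * P(y is reached from v but not from S)`.

As `∑ v, x v ≤ k`, some node has marginal gain at least `(σ(π) - OPT_N - σ(S)) / k` over `S`, and
adding such nodes greedily produces a set of size `k` whose spread is at least
`(1 - 1/e) * (σ(π) - OPT_N)`. Hence `OPT_A ≤ (1 + e/(e-1)) * OPT_N`, and `1 ≤ e/(e-1)`.
-/

namespace InfluenceGraph

noncomputable section

open scoped Classical

variable {V : Type u}

/-! ### Expectation over live-edge graphs -/

theorem liveProb_nonneg (G : InfluenceGraph V) (L : Finset (V × V)) : 0 ≤ G.liveProb L := by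
  refine Finset.prod_nonneg fun e he => ?_
  have := G.prob_mem e he
  split_ifs
  · exact this.1
  · linarith [this.2]

theorem expect_mono (G : InfluenceGraph V) {f g : Finset (V × V) → ℝ}
    (h : ∀ L ⊆ G.edges, f L ≤ g L) : G.expect f ≤ G.expect g :=
  Finset.sum_le_sum fun L hL =>
    mul_le_mul_of_nonneg_left (h L (Finset.mem_powerset.1 hL)) (G.liveProb_nonneg L)

theorem expect_congr (G : InfluenceGraph V) {f g : Finset (V × V) → ℝ}
    (h : ∀ L ⊆ G.edges, f L = g L) : G.expect f = G.expect g :=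
  Finset.sum_congr rfl fun L hL => by rw [h L (Finset.mem_powerset.1 hL)]

theorem expect_add (G : InfluenceGraph V) (f g : Finset (V × V) → ℝ) :
    G.expect (fun L => f L + g L) = G.expect f + G.expect g := by
  simp only [expect, mul_add, Finset.sum_add_distrib]

theorem expect_sum (G : InfluenceGraph V) {ι : Type*} (s : Finset ι)
    (f : ι → Finset (V × V) → ℝ) :
    G.expect (fun L => ∑ i ∈ s, f i L) = ∑ i ∈ s, G.expect (f i) := by
  simp only [expect, Finset.mul_sum]
  exact Finset.sum_comm

theorem expect_mul_const (G : InfluenceGraph V) (f : Finset (V × V) → ℝ) (c : ℝ) :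
    G.expect (fun L => f L * c) = G.expect f * c := by
  simp only [expect, Finset.sum_mul, mul_assoc]

/-- The probability that, among the edges in `A`, exactly those in `L` are live. -/
def liveProbOn (G : InfluenceGraph V) (A L : Finset (V × V)) : ℝ :=
  ∏ e ∈ A, if e ∈ L then G.prob e else 1 - G.prob e

theorem sum_liveProbOn (G : InfluenceGraph V) (A : Finset (V × V)) :
    ∑ L ∈ A.powerset, G.liveProbOn A L = 1 := by
  have h := Finset.prod_add (fun e => G.prob e) (fun e => 1 - G.prob e) A
  simp only [add_sub_cancel, Finset.prod_const_one] at h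
  rw [h]
  refine Finset.sum_congr rfl fun L hL => ?_
  have hL := Finset.mem_powerset.1 hL
  rw [liveProbOn, Finset.prod_ite, Finset.filter_mem_eq_inter, Finset.filter_notMem_eq_sdiff,
    Finset.inter_eq_right.2 hL]

/-- A live-edge graph consists of two independent parts, inside and outside a set of edges. -/
theorem expect_mul_eq_sum_mul_sum (G : InfluenceGraph V) {A : Finset (V × V)} (hA : A ⊆ G.edges)
    (f g : Finset (V × V) → ℝ) :
    G.expect (fun L => f (L ∩ A) * g (L \ A)) =
      (∑ L ∈ A.powerset, G.liveProbOn A L * f L) *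
        ∑ L ∈ (G.edges \ A).powerset, G.liveProbOn (G.edges \ A) L * g L := by
  rw [Finset.sum_mul_sum, ← Finset.sum_product', expect]
  refine Finset.sum_nbij' (fun L => (L ∩ A, L \ A)) (fun q => q.1 ∪ q.2) ?_ ?_ ?_ ?_ ?_
  · intro L hL
    simp only [Finset.mem_powerset, Finset.mem_product] at hL ⊢
    exact ⟨Finset.inter_subset_right, Finset.sdiff_subset_sdiff hL le_rfl⟩
  · intro q hq
    simp only [Finset.mem_powerset, Finset.mem_product] at hq ⊢
    exact Finset.union_subset (hq.1.trans hA) (hq.2.trans Finset.sdiff_subset)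
  · intro L _
    ext e
    simp only [Finset.mem_union, Finset.mem_inter, Finset.mem_sdiff]
    tauto
  · rintro ⟨L₁, L₂⟩ hq
    simp only [Finset.mem_powerset, Finset.mem_product] at hq
    have h2 : ∀ e ∈ L₂, e ∉ A := fun e he => (Finset.mem_sdiff.1 (hq.2 he)).2
    have h1 : ∀ e ∈ L₁, e ∈ A := fun e he => hq.1 he
    ext e <;> simp only [Finset.mem_union, Finset.mem_inter, Finset.mem_sdiff] <;>
      have := h1 e <;> have := h2 e <;> tauto
  · intro L _
    have : G.liveProb L = G.liveProbOn A (L ∩ A) * G.liveProbOn (G.edges \ A) (L \ A) := by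
      rw [liveProb, ← Finset.prod_sdiff hA, mul_comm]
      refine congrArg₂ _ (Finset.prod_congr rfl fun e he => ?_)
        (Finset.prod_congr rfl fun e he => ?_)
      · simp [he]
      · simp [(Finset.mem_sdiff.1 he).2]
    rw [this]
    ring

theorem expect_mul_of_indep (G : InfluenceGraph V) {A : Finset (V × V)} (hA : A ⊆ G.edges)
    {f g : Finset (V × V) → ℝ} (hf : ∀ L ⊆ G.edges, f (L ∩ A) = f L)
    (hg : ∀ L ⊆ G.edges, g (L \ A) = g L) :
    G.expect (fun L => f L * g L) = G.expect f * G.expect g := by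
  have hfg := G.expect_mul_eq_sum_mul_sum hA f g
  have hf1 := G.expect_mul_eq_sum_mul_sum hA f (fun _ => 1)
  have hg1 := G.expect_mul_eq_sum_mul_sum hA (fun _ => 1) g
  simp only [mul_one, one_mul, sum_liveProbOn] at hf1 hg1
  rw [← hf1, ← hg1] at hfg
  rwa [G.expect_congr (fun L hL => by rw [hf L hL, hg L hL]), G.expect_congr hf,
    G.expect_congr hg] at hfg

theorem expect_const (G : InfluenceGraph V) (c : ℝ) : G.expect (fun _ => c) = c := by
  have h : ∑ L ∈ G.edges.powerset, G.liveProb L = 1 := G.sum_liveProbOn G.edges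
  rw [expect, ← Finset.sum_mul, h, one_mul]

/-- The probability of an event. -/
def pr (G : InfluenceGraph V) (p : Finset (V × V) → Prop) : ℝ :=
  G.expect fun L => if p L then 1 else 0

theorem pr_eq_expect (G : InfluenceGraph V) (p : Finset (V × V) → Prop) [DecidablePred p] :
    G.pr p = G.expect fun L => if p L then 1 else 0 := by
  unfold pr
  congr!

theorem pr_mono (G : InfluenceGraph V) {p q : Finset (V × V) → Prop}
    (h : ∀ L ⊆ G.edges, p L → q L) : G.pr p ≤ G.pr q := by
  refine G.expect_mono fun L hL => ?_
  have := h L hL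
  by_cases hp : p L
  · rw [if_pos hp, if_pos (this hp)]
  · rw [if_neg hp]
    positivity

theorem pr_nonneg (G : InfluenceGraph V) (p : Finset (V × V) → Prop) : 0 ≤ G.pr p := by
  rw [← G.expect_const 0]
  exact G.expect_mono fun L _ => by split_ifs <;> norm_num

theorem pr_and_of_indep (G : InfluenceGraph V) {A : Finset (V × V)} (hA : A ⊆ G.edges)
    {p q : Finset (V × V) → Prop} (hp : ∀ L ⊆ G.edges, p (L ∩ A) ↔ p L)
    (hq : ∀ L ⊆ G.edges, q (L \ A) ↔ q L) :
    G.pr (fun L => p L ∧ q L) = G.pr p * G.pr q := by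
  unfold pr
  rw [← G.expect_mul_of_indep hA (fun L hL => by simp only [hp L hL])
    (fun L hL => by simp only [hq L hL])]
  refine G.expect_congr fun L _ => ?_
  by_cases h1 : p L <;> by_cases h2 : q L <;> simp [h1, h2]

/-! ### Reachability and the edges it depends on -/

/-- `b` is reachable from `a` along edges in `L`. -/
abbrev Reaches (L : Finset (V × V)) (a b : V) : Prop :=
  Relation.ReflTransGen (fun a b => (a, b) ∈ L) a b

theorem Reaches.mono {L L' : Finset (V × V)} (h : L ⊆ L') {a b : V} (hab : Reaches L a b) :
    Reaches L' a b :=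
  Relation.ReflTransGen.mono (fun _ _ hh => h hh) _ _ hab

theorem mem_reach [Fintype V] {S : Finset V} {L : Finset (V × V)} {v : V} :
    v ∈ reach S L ↔ ∃ s ∈ S, Reaches L s v := by
  simp [reach]

/-- No node of `P` is reachable from `S` along edges in `L`. -/
def Avoids (S P : Set V) (L : Finset (V × V)) : Prop :=
  ∀ s ∈ S, ∀ z, Reaches L s z → z ∉ P

/-- A cascade that avoids `P` is not affected by the edges leaving `P`. -/
theorem reaches_congr {L L' : Finset (V × V)} {P : Set V}
    (hL : ∀ e : V × V, e.1 ∉ P → (e ∈ L ↔ e ∈ L')) {s : V}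
    (hs : ∀ z, Reaches L s z → z ∉ P) (z : V) : Reaches L' s z ↔ Reaches L s z := by
  constructor
  · intro h
    induction h with
    | refl => exact .refl
    | tail _ hbc ih => exact ih.tail ((hL _ (hs _ ih)).2 hbc)
  · intro h
    induction h with
    | refl => exact .refl
    | tail hab hbc ih => exact ih.tail ((hL _ (hs _ hab)).1 hbc)

theorem Avoids.congr {L L' : Finset (V × V)} {S P : Set V}
    (hL : ∀ e : V × V, e.1 ∉ P → (e ∈ L ↔ e ∈ L')) (h : Avoids S P L) : Avoids S P L' :=
  fun s hs z hz => h s hs z ((reaches_congr hL (h s hs) z).1 hz)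

/-- The nodes on a path from `v` to `y` in the graph `G`. -/
def between (G : InfluenceGraph V) (v y : V) : Set V :=
  {z | Reaches G.edges v z ∧ Reaches G.edges z y}

/-- The edges of `G` that leave a node of `P`. -/
def outEdges (G : InfluenceGraph V) (P : Set V) : Finset (V × V) :=
  G.edges.filter fun e => e.1 ∈ P

theorem outEdges_subset (G : InfluenceGraph V) (P : Set V) : G.outEdges P ⊆ G.edges :=
  Finset.filter_subset _ _

theorem mem_sdiff_outEdges_iff (G : InfluenceGraph V) {P : Set V} (L : Finset (V × V))
    (e : V × V) (he : e.1 ∉ P) : e ∈ L \ G.outEdges P ↔ e ∈ L := by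
  simp [outEdges, he]

theorem reaches_inter_outEdges_between (G : InfluenceGraph V) {L : Finset (V × V)}
    (hL : L ⊆ G.edges) (v y : V) :
    Reaches (L ∩ G.outEdges (G.between v y)) v y ↔ Reaches L v y := by
  refine ⟨Reaches.mono Finset.inter_subset_left, fun h => ?_⟩
  have key : ∀ x, Reaches L x y → Reaches G.edges v x →
      Reaches (L ∩ G.outEdges (G.between v y)) x y := by
    intro x hx
    induction hx using Relation.ReflTransGen.head_induction_on with
    | refl => exact fun _ => .refl
    | head hac hcy ih =>
      intro hva
      refine .head ?_ (ih (hva.tail (hL hac)))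
      refine Finset.mem_inter.2 ⟨hac, Finset.mem_filter.2 ⟨hL hac, hva, ?_⟩⟩
      exact .head (hL hac) (Reaches.mono hL hcy)
  exact key v h .refl

theorem avoids_sdiff_outEdges (G : InfluenceGraph V) (S P : Set V) (L : Finset (V × V)) :
    Avoids S P (L \ G.outEdges P) ↔ Avoids S P L :=
  ⟨Avoids.congr fun e he => G.mem_sdiff_outEdges_iff L e he,
    Avoids.congr fun e he => (G.mem_sdiff_outEdges_iff L e he).symm⟩

theorem pr_reaches_mul_pr_avoids (G : InfluenceGraph V) (S : Set V) (v y : V) :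
    G.pr (fun L => Reaches L v y) * G.pr (Avoids S (G.between v y)) =
      G.pr (fun L => Reaches L v y ∧ Avoids S (G.between v y) L) :=
  (G.pr_and_of_indep (G.outEdges_subset (G.between v y))
    (fun _ hL => G.reaches_inter_outEdges_between hL v y)
    (fun _ _ => G.avoids_sdiff_outEdges S _ _)).symm

/-! ### In-arborescences -/

/-- Along an edge, the tree path to the root gets shorter by exactly that edge. -/
theorem exists_root_path (G : InfluenceGraph V) (hG : G.IsInArborescence) :
    ∃ (r : V) (path : ∀ v, G.underlying.Walk v r), ∀ a b, (a, b) ∈ G.edges →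
      ∃ h : G.underlying.Adj a b, path a = .cons h (path b) := by
  obtain ⟨hopp, htree, r, hr⟩ := hG
  choose path hpath huniq using fun v => htree.existsUnique_path v r
  refine ⟨r, path, fun a b hab => ?_⟩
  have hne : a ≠ b := by
    rintro rfl
    exact hopp _ _ hab hab
  have hadj : G.underlying.Adj a b := by
    rw [underlying, SimpleGraph.fromRel_adj]
    exact ⟨hne, Or.inl hab⟩
  refine ⟨hadj, (huniq a _ ?_).symm⟩
  refine (SimpleGraph.Walk.cons_isPath_iff _ _).2
     ⟨hpath b, fun ha => hopp _ _ hab ?_⟩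
  -- If `a` lay on the path from `b` to the root, that path would start with the step `b → a`.
  have h1 : ((path b).takeUntil a ha).IsPath := (hpath b).takeUntil ha
  have h2 : (SimpleGraph.Walk.cons hadj.symm .nil : G.underlying.Walk b a).IsPath := by
    simp [SimpleGraph.Walk.cons_isPath_iff, hne.symm]
  have h3 := (htree.existsUnique_path b a).unique h1 h2
  refine hr b (path b) (hpath b) ⟨(b, a), hadj.symm⟩ ?_
  apply SimpleGraph.Walk.darts_takeUntil_subset_darts (path b) ha
  rw [h3]
  simp

theorem IsInArborescence.rightUnique {G : InfluenceGraph V} (hG : G.IsInArborescence)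
    {a b c : V} (hb : (a, b) ∈ G.edges) (hc : (a, c) ∈ G.edges) : b = c := by
  obtain ⟨r, path, h⟩ := G.exists_root_path hG
  obtain ⟨h1, e1⟩ := h a b hb
  obtain ⟨h2, e2⟩ := h a c hc
  rw [e1] at e2
  simp only [SimpleGraph.Walk.cons.injEq] at e2
  exact e2.1

theorem IsInArborescence.reaches_antisymm {G : InfluenceGraph V} (hG : G.IsInArborescence)
    {a b : V} (hab : Reaches G.edges a b) (hba : Reaches G.edges b a) : a = b := by
  obtain ⟨r, path, h⟩ := G.exists_root_path hG
  have key : ∀ {a b : V}, Reaches G.edges a b → a = b ∨ (path b).length < (path a).length := by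
    intro a b hab
    induction hab with
    | refl => exact Or.inl rfl
    | @tail b c _ hbc ih =>
      obtain ⟨h1, e1⟩ := h _ _ hbc
      have hlen : (path b).length = (path c).length + 1 := by
        rw [e1, SimpleGraph.Walk.length_cons]
      right
      rcases ih with rfl | ih <;> omega
  rcases key hab with h1 | h1
  · exact h1
  · rcases key hba with h2 | h2
    · exact h2.symm
    · omega

/-- Paths are unique: if `y` is reached from `v` in `L`, then all of the path is live. -/
theorem IsInArborescence.reaches_of_mem_between {G : InfluenceGraph V}
    (hG : G.IsInArborescence) {L : Finset (V × V)} (hL : L ⊆ G.edges) {v y z : V}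
    (h : Reaches L v y) (hz : z ∈ G.between v y) : Reaches L z y := by
  obtain ⟨hvz, hzy⟩ := hz
  induction h using Relation.ReflTransGen.head_induction_on with
  | refl => rw [hG.reaches_antisymm hvz hzy]
  | head hac hcy ih =>
    rcases hvz.cases_head with rfl | ⟨u, hau, huz⟩
    · exact .head hac hcy
    · obtain rfl := hG.rightUnique hau (hL hac)
      exact ih huz

/-- The nodes at which the cascades from `S` along `L` end. -/
def cascadeEnds [Fintype V] (S : Finset V) (L : Finset (V × V)) : Finset V :=
  (reach S L).filter fun w => ∀ u, (w, u) ∉ L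

theorem IsInArborescence.card_cascadeEnds_le [Fintype V] {G : InfluenceGraph V}
    (hG : G.IsInArborescence) (S : Finset V) {L : Finset (V × V)} (hL : L ⊆ G.edges) :
    (cascadeEnds S L).card ≤ S.card := by
  have h : ∀ w : V, ∃ s : V, w ∈ cascadeEnds S L → s ∈ S ∧ Reaches L s w := by
    intro w
    by_cases hw : w ∈ cascadeEnds S L
    · obtain ⟨s, hs⟩ := mem_reach.1 (Finset.mem_filter.1 hw).1
      exact ⟨s, fun _ => hs⟩
    · exact ⟨w, fun h => absurd h hw⟩
  choose f hf using h
  refine Finset.card_le_card_of_injOn f (fun w hw => (hf w hw).1) ?_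
  intro w hw w' hw' hww
  have h1 := (hf w hw).2
  have h2 := (hf w' hw').2
  rw [← hww] at h2
  -- Two ends of the same cascade are comparable, but nothing else is reached from an end.
  have hend : ∀ {a b : V}, a ∈ cascadeEnds S L → Reaches L a b → a = b := by
    intro a b ha hab
    rcases hab.cases_head with h | ⟨c, hac, _⟩
    · exact h
    · exact absurd hac ((Finset.mem_filter.1 ha).2 c)
  have huniq : Relator.RightUnique fun a b => (a, b) ∈ L :=
    fun a b c hb hc => hG.rightUnique (hL hb) (hL hc)
  rcases Relation.ReflTransGen.total_of_right_unique huniq h1 h2 with h | h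
  · exact hend hw h
  · exact (hend hw' h).symm

/-- A path in `L` can leave the set reached from `S` in `L'` only at the end of a cascade. -/
theorem IsInArborescence.mem_reach_cascadeEnds [Fintype V] {G : InfluenceGraph V}
    (hG : G.IsInArborescence) {S : Finset V} {L L' : Finset (V × V)} (hL : L ⊆ G.edges)
    (hL' : L' ⊆ G.edges) {z y : V} (hz : z ∈ reach S L') (hzy : Reaches L z y)
    (hy : y ∉ reach S L') : y ∈ reach (cascadeEnds S L') L := by
  induction hzy using Relation.ReflTransGen.head_induction_on with
  | refl => exact absurd hz hy
  | @head a c hac hcy ih =>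
    by_cases hc : c ∈ reach S L'
    · exact ih hc
    · refine mem_reach.2 ⟨a, Finset.mem_filter.2 ⟨hz, fun u hau => hc ?_⟩, .head hac hcy⟩
      obtain rfl := hG.rightUnique (hL hac) (hL' hau)
      obtain ⟨s, hs, hsa⟩ := mem_reach.1 hz
      exact mem_reach.2 ⟨s, hs, hsa.tail hau⟩

/-! ### What a policy can depend on -/

theorem mem_dom_insert {ψ : PartialRealization V} {v w : V} {o : Feedback V} :
    w ∈ PartialRealization.dom (insert (v, o) ψ : Set (V × Feedback V)) ↔ w = v ∨ w ∈ ψ.dom := by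
  simp only [PartialRealization.dom, Set.mem_ofPred_eq, Set.mem_insert_iff, Prod.mk.injEq,
    exists_or, exists_and_left, exists_eq, and_true]

variable [Fintype V]

theorem feedback_congr (G : InfluenceGraph V) {L L' : Finset (V × V)} {P : Set V}
    (hL : ∀ e : V × V, e.1 ∉ P → (e ∈ L ↔ e ∈ L')) {s : V}
    (hs : ∀ z, Reaches L s z → z ∉ P) : G.feedback L' s = G.feedback L s := by
  funext e
  have h1 : e.1 ∈ reach {s} L' ↔ e.1 ∈ reach {s} L := by
    simp only [mem_reach, Finset.mem_singleton, exists_eq_left]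
    exact reaches_congr hL hs e.1
  unfold feedback
  by_cases he : e ∈ G.edges ∧ e.1 ∈ reach {s} L
  · rw [if_pos he, if_pos ⟨he.1, h1.2 he.2⟩]
    have h2 : Reaches L s e.1 := by simpa [mem_reach] using he.2
    simp only [hL e (hs _ h2)]
  · rw [if_neg he, if_neg fun h => he ⟨h.1, h1.1 h.2⟩]

theorem observe_succ_of_some (G : InfluenceGraph V) {π : AdaptivePolicy V}
    {L : Finset (V × V)} {t : ℕ} {v : V} (h : π (G.observe π L t) = some v) :
    G.observe π L (t + 1) = insert (v, G.feedback L v) (G.observe π L t) := by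
  simp only [observe, h]

theorem observe_succ_of_none (G : InfluenceGraph V) {π : AdaptivePolicy V}
    {L : Finset (V × V)} {t : ℕ} (h : π (G.observe π L t) = none) :
    G.observe π L (t + 1) = G.observe π L t := by
  simp only [observe, h]

/-- As long as no node of `P` is reached, the observations do not depend on the edges
leaving `P`. -/
theorem observe_congr (G : InfluenceGraph V) (π : AdaptivePolicy V) {L L' : Finset (V × V)}
    {P : Set V} (hL : ∀ e : V × V, e.1 ∉ P → (e ∈ L ↔ e ∈ L')) (t : ℕ)
    (h : Avoids (G.observe π L t).dom P L) : G.observe π L' t = G.observe π L t := by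
  induction t with
  | zero => rfl
  | succ t ih =>
    cases hπ : π (G.observe π L t) with
    | none =>
      rw [G.observe_succ_of_none hπ] at h ⊢
      rw [← ih h] at hπ
      rw [G.observe_succ_of_none hπ, ih h]
    | some v =>
      rw [G.observe_succ_of_some hπ] at h ⊢
      have ih := ih fun s hs => h s (mem_dom_insert.2 (Or.inr hs))
      rw [← ih] at hπ
      rw [G.observe_succ_of_some hπ, ih,
        G.feedback_congr hL (h v (mem_dom_insert.2 (Or.inl rfl)))]

/-- The event that `π` selects `v` at a time when no node between `v` and `y` is reached yet. -/
def SelectsAhead (G : InfluenceGraph V) (π : AdaptivePolicy V) (v y : V)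
    (L : Finset (V × V)) : Prop :=
  ∃ t, π (G.observe π L t) = some v ∧ Avoids (G.observe π L t).dom (G.between v y) L

theorem SelectsAhead.congr {G : InfluenceGraph V} {π : AdaptivePolicy V} {v y : V}
    {L L' : Finset (V × V)} (hL : ∀ e : V × V, e.1 ∉ G.between v y → (e ∈ L ↔ e ∈ L'))
    (h : G.SelectsAhead π v y L) : G.SelectsAhead π v y L' := by
  obtain ⟨t, hv, ht⟩ := h
  have := G.observe_congr π hL t ht
  exact ⟨t, by rw [this, hv], by rw [this]; exact ht.congr hL⟩

theorem SelectsAhead.mem_seeds {G : InfluenceGraph V} {π : AdaptivePolicy V} {v y : V}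
    {L : Finset (V × V)} (h : G.SelectsAhead π v y L) : v ∈ G.seeds π L := by
  obtain ⟨t, hv, -⟩ := h
  refine Finset.mem_filter.2 ⟨Finset.mem_univ _, t + 1, ?_⟩
  rw [G.observe_succ_of_some hv]
  exact mem_dom_insert.2 (Or.inl rfl)

/-- The first seed from which `y` is reached is selected ahead of the path to `y`. -/
theorem IsInArborescence.exists_selectsAhead {G : InfluenceGraph V} (hG : G.IsInArborescence)
    (π : AdaptivePolicy V) {L : Finset (V × V)} (hL : L ⊆ G.edges) {y : V}
    (hy : y ∈ reach (G.seeds π L) L) : ∃ v, G.SelectsAhead π v y L ∧ Reaches L v y := by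
  have hex : ∃ t, ∃ s ∈ (G.observe π L t).dom, Reaches L s y := by
    obtain ⟨s, hs, hsy⟩ := mem_reach.1 hy
    obtain ⟨t, ht⟩ := (Finset.mem_filter.1 hs).2
    exact ⟨t, s, ht, hsy⟩
  obtain ⟨s, hs, hsy⟩ := Nat.find_spec hex
  have hmin := fun {t} => Nat.find_min (m := t) hex
  generalize Nat.find hex = n at hs hmin
  cases n with
  | zero => simp [observe, PartialRealization.dom] at hs
  | succ t =>
    have ht := hmin (Nat.lt_succ_self t)
    cases hπ : π (G.observe π L t) with
    | none =>
      rw [G.observe_succ_of_none hπ] at hs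
      exact absurd ⟨s, hs, hsy⟩ ht
    | some v =>
      rw [G.observe_succ_of_some hπ, mem_dom_insert] at hs
      rcases hs with rfl | hs
      · refine ⟨s, ⟨t, hπ, fun w hw z hwz hz => ht ⟨w, hw, ?_⟩⟩, hsy⟩
        exact hwz.trans (hG.reaches_of_mem_between hL hsy hz)
      · exact absurd ⟨s, hs, hsy⟩ ht

theorem pr_selectsAhead_and_reaches_le (G : InfluenceGraph V) (π : AdaptivePolicy V) (v y : V) :
    G.pr (fun L => Reaches L v y ∧ G.SelectsAhead π v y L) ≤
      G.pr (fun L => Reaches L v y) * G.pr (fun L => v ∈ G.seeds π L) := by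
  rw [G.pr_and_of_indep (G.outEdges_subset (G.between v y))
    (fun L hL => G.reaches_inter_outEdges_between hL v y)
    (fun _ _ => ⟨SelectsAhead.congr fun e he => G.mem_sdiff_outEdges_iff _ e he,
      SelectsAhead.congr fun e he => (G.mem_sdiff_outEdges_iff _ e he).symm⟩)]
  exact mul_le_mul_of_nonneg_left (G.pr_mono fun L _ h => h.mem_seeds) (G.pr_nonneg _)

/-! ### The adaptive spread against a non-adaptive set -/

/-- What `π` reaches in `L`, compared with what `S` reaches in another live-edge graph `L'`. -/
theorem IsInArborescence.card_reach_seeds_le {G : InfluenceGraph V} (hG : G.IsInArborescence)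
    (π : AdaptivePolicy V) (S : Finset V) {L L' : Finset (V × V)} (hL : L ⊆ G.edges)
    (hL' : L' ⊆ G.edges) :
    ((reach (G.seeds π L) L).card : ℝ) ≤ (reach S L').card + (reach (cascadeEnds S L') L).card +
      ∑ v, ∑ y, (if Reaches L v y ∧ G.SelectsAhead π v y L then 1 else 0) *
        (if Avoids S (G.between v y) L' then (1 : ℝ) else 0) := by
  set R : Finset V := Finset.univ.filter fun y =>
    ∃ v, (Reaches L v y ∧ G.SelectsAhead π v y L) ∧ Avoids S (G.between v y) L' with hR
  have hsub : reach (G.seeds π L) L ⊆ reach S L' ∪ reach (cascadeEnds S L') L ∪ R := by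
    intro y hy
    obtain ⟨v, hv, hvy⟩ := hG.exists_selectsAhead π hL hy
    simp only [Finset.mem_union]
    by_cases hyS : y ∈ reach S L'
    · exact Or.inl (Or.inl hyS)
    by_cases hav : Avoids S (G.between v y) L'
    · exact Or.inr (Finset.mem_filter.2 ⟨Finset.mem_univ _, v, ⟨hvy, hv⟩, hav⟩)
    · simp only [Avoids, not_forall, not_not] at hav
      obtain ⟨s, hs, z, hsz, hz⟩ := hav
      exact Or.inl (Or.inr (hG.mem_reach_cascadeEnds hL hL' (mem_reach.2 ⟨s, hs, hsz⟩)
        (hG.reaches_of_mem_between hL hvy hz) hyS))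
  have hcard : ((reach (G.seeds π L) L).card : ℝ) ≤
      (reach S L').card + (reach (cascadeEnds S L') L).card + R.card := by
    exact_mod_cast (Finset.card_le_card hsub).trans ((Finset.card_union_le _ _).trans
      (Nat.add_le_add_right (Finset.card_union_le _ _) _))
  refine hcard.trans (add_le_add_right ?_ _)
  rw [Finset.sum_comm, hR, Finset.natCast_card_filter]
  refine Finset.sum_le_sum fun y _ => ?_
  have hnn : ∀ v ∈ (Finset.univ : Finset V),
      (0 : ℝ) ≤ (if Reaches L v y ∧ G.SelectsAhead π v y L then 1 else 0) *
        (if Avoids S (G.between v y) L' then (1 : ℝ) else 0) := fun v _ => by positivity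
  split_ifs with h
  · obtain ⟨v, hv, hav⟩ := h
    refine le_trans ?_ (Finset.single_le_sum hnn (Finset.mem_univ v))
    rw [if_pos hv, if_pos hav, one_mul]
  · exact Finset.sum_nonneg hnn

theorem spread_le_optN (G : InfluenceGraph V) {k : ℕ} {S : Finset V} (hS : S.card ≤ k) :
    G.spread S ≤ G.optN k :=
  (G.optN_isGreatest k).2 ⟨S, hS, rfl⟩

theorem sum_pr_reaches_and_avoids_le (G : InfluenceGraph V) (S : Finset V) (v : V) :
    ∑ y, G.pr (fun L => Reaches L v y ∧ Avoids S (G.between v y) L) ≤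
      G.spread (insert v S) - G.spread S := by
  rw [le_sub_iff_add_le]
  simp only [pr_eq_expect, spread]
  rw [← expect_sum, ← expect_add]
  refine G.expect_mono fun L hL => ?_
  rw [← Finset.natCast_card_filter]
  norm_cast
  rw [← Finset.card_union_of_disjoint]
  · refine Finset.card_le_card fun y hy => ?_
    rcases Finset.mem_union.1 hy with h | h
    · exact mem_reach.2 ⟨v, Finset.mem_insert_self _ _, (Finset.mem_filter.1 h).2.1⟩
    · obtain ⟨s, hs, hsy⟩ := mem_reach.1 h
      exact mem_reach.2 ⟨s, Finset.mem_insert_of_mem hs, hsy⟩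
  · rw [Finset.disjoint_left]
    intro y hy hyS
    obtain ⟨hvy, hav⟩ := (Finset.mem_filter.1 hy).2
    obtain ⟨s, hs, hsy⟩ := mem_reach.1 hyS
    exact hav s hs y hsy ⟨Reaches.mono hL hvy, .refl⟩

/-- An adaptive policy beats a set `S` by at most `OPT_N` plus the marginal gains over `S`,
weighted with the probabilities that the policy selects the nodes. -/
theorem IsInArborescence.adaptiveSpread_le {G : InfluenceGraph V} (hG : G.IsInArborescence)
    (π : AdaptivePolicy V) {k : ℕ} {S : Finset V} (hS : S.card ≤ k) :
    G.adaptiveSpread π ≤ G.spread S + G.optN k +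
      ∑ v, G.pr (fun L => v ∈ G.seeds π L) * (G.spread (insert v S) - G.spread S) := by
  have h1 : ∀ L' ⊆ G.edges, G.adaptiveSpread π ≤ (reach S L').card + G.optN k +
      ∑ v, ∑ y, (if Avoids S (G.between v y) L' then (1 : ℝ) else 0) *
        (G.pr (fun L => Reaches L v y) * G.pr (fun L => v ∈ G.seeds π L)) := by
    intro L' hL'
    have h := G.expect_mono fun L hL => hG.card_reach_seeds_le π S hL hL'
    rw [expect_add, expect_add, expect_const, expect_sum] at h
    refine h.trans (add_le_add (add_le_add_right ?_ _) (Finset.sum_le_sum fun v _ => ?_))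
    · exact G.spread_le_optN ((hG.card_cascadeEnds_le S hL').trans hS)
    · rw [expect_sum]
      refine Finset.sum_le_sum fun y _ => ?_
      rw [expect_mul_const, mul_comm]
      rw [← G.pr_eq_expect fun L => Reaches L v y ∧ G.SelectsAhead π v y L]
      exact mul_le_mul_of_nonneg_left (G.pr_selectsAhead_and_reaches_le π v y) (by positivity)
  have h2 := G.expect_mono h1
  rw [expect_const, expect_add, expect_add, expect_const, expect_sum] at h2
  refine h2.trans (add_le_add_right (Finset.sum_le_sum fun v _ => ?_) _)
  rw [expect_sum]
  refine le_trans (le_of_eq ?_) (mul_le_mul_of_nonneg_left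
    (G.sum_pr_reaches_and_avoids_le S v) (G.pr_nonneg _))
  rw [Finset.mul_sum]
  refine Finset.sum_congr rfl fun y _ => ?_
  rw [expect_mul_const, ← G.pr_reaches_mul_pr_avoids]
  change G.pr _ * _ = _
  ring

theorem sum_pr_mem_seeds_le (G : InfluenceGraph V) {π : AdaptivePolicy V} {k : ℕ}
    (hπ : G.IsFeasible k π) : ∑ v, G.pr (fun L => v ∈ G.seeds π L) ≤ k := by
  simp only [pr_eq_expect]
  rw [← expect_sum, ← G.expect_const k]
  refine G.expect_mono fun L hL => ?_
  rw [← Finset.natCast_card_filter, Finset.filter_univ_mem]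
  exact_mod_cast hπ L hL

/-! ### The greedy argument -/

theorem spread_le_spread_insert (G : InfluenceGraph V) (S : Finset V) (v : V) :
    G.spread S ≤ G.spread (insert v S) := by
  refine G.expect_mono fun L _ => ?_
  exact_mod_cast Finset.card_le_card fun y hy => by
    obtain ⟨s, hs, hsy⟩ := mem_reach.1 hy
    exact mem_reach.2 ⟨s, Finset.mem_insert_of_mem hs, hsy⟩

theorem IsInArborescence.exists_greedy_step {G : InfluenceGraph V} (hG : G.IsInArborescence)
    {π : AdaptivePolicy V} {k : ℕ} (hπ : G.IsFeasible k π) {S : Finset V}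
    (hS : S.card ≤ k) :
    ∃ v, G.adaptiveSpread π - G.optN k ≤
      G.spread S + k * (G.spread (insert v S) - G.spread S) := by
  have : Nonempty V := hG.2.1.connected.nonempty
  obtain ⟨v, hv⟩ := Finite.exists_max fun v => G.spread (insert v S) - G.spread S
  refine ⟨v, ?_⟩
  have h1 := hG.adaptiveSpread_le π hS
  have h2 : ∑ w, G.pr (fun L => w ∈ G.seeds π L) * (G.spread (insert w S) - G.spread S) ≤
      k * (G.spread (insert v S) - G.spread S) := by
    calc _ ≤ ∑ w, G.pr (fun L => w ∈ G.seeds π L) * (G.spread (insert v S) - G.spread S) :=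
          Finset.sum_le_sum fun w _ => mul_le_mul_of_nonneg_left (hv w) (G.pr_nonneg _)
      _ = (∑ w, G.pr (fun L => w ∈ G.seeds π L)) * (G.spread (insert v S) - G.spread S) :=
          (Finset.sum_mul ..).symm
      _ ≤ _ := mul_le_mul_of_nonneg_right (G.sum_pr_mem_seeds_le hπ)
          (sub_nonneg.2 (G.spread_le_spread_insert S v))
  linarith

theorem spread_nonneg (G : InfluenceGraph V) (S : Finset V) : 0 ≤ G.spread S := by
  rw [← G.expect_const 0]
  exact G.expect_mono fun L _ => by positivity

theorem IsInArborescence.exists_greedy_set {G : InfluenceGraph V} (hG : G.IsInArborescence)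
    {π : AdaptivePolicy V} {k : ℕ} (hk : 1 ≤ k) (hπ : G.IsFeasible k π) (i : ℕ) (hi : i ≤ k) :
    ∃ S : Finset V, S.card ≤ i ∧ G.adaptiveSpread π - G.optN k - G.spread S ≤
      (1 - 1 / (k : ℝ)) ^ i * (G.adaptiveSpread π - G.optN k) := by
  have hk0 : (0 : ℝ) < k := by exact_mod_cast hk
  induction i with
  | zero => exact ⟨∅, by simp, by linarith [G.spread_nonneg ∅]⟩
  | succ i ih =>
    obtain ⟨S, hS, hSi⟩ := ih (by omega)
    obtain ⟨v, hv⟩ := hG.exists_greedy_step hπ (hS.trans (by omega))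
    refine ⟨insert v S, (Finset.card_insert_le v S).trans (by omega), ?_⟩
    set M := G.adaptiveSpread π - G.optN k
    have hc : (0 : ℝ) ≤ 1 - 1 / k := by
      rw [sub_nonneg, div_le_one hk0]
      exact_mod_cast hk
    have h1 : (M - G.spread S) / k ≤ G.spread (insert v S) - G.spread S := by
      rw [div_le_iff₀ hk0]
      linarith
    calc M - G.spread (insert v S) ≤ (1 - 1 / k) * (M - G.spread S) := by
          have : (1 - 1 / (k : ℝ)) * (M - G.spread S) =
            M - G.spread S - (M - G.spread S) / k := by ring
          linarith
      _ ≤ (1 - 1 / k) * ((1 - 1 / k) ^ i * M) := mul_le_mul_of_nonneg_left hSi hc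
      _ = _ := by ring

theorem IsInArborescence.optA_le {G : InfluenceGraph V} (hG : G.IsInArborescence) {k : ℕ}
    (hk : 1 ≤ k) : G.optA k ≤ 2 * Real.exp 1 / (Real.exp 1 - 1) * G.optN k := by
  obtain ⟨π, hπ, hopt⟩ := (G.optA_isGreatest k).1
  obtain ⟨S, hS, hM⟩ := hG.exists_greedy_set hk hπ k le_rfl
  rw [hopt] at hM
  have hSN := G.spread_le_optN hS
  have hN : 0 ≤ G.optN k := (G.spread_nonneg S).trans hSN
  have he : 1 < Real.exp 1 := by simp
  have hpow : (1 - 1 / (k : ℝ)) ^ k ≤ Real.exp (-1) :=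
    Real.one_sub_div_pow_le_exp_neg (by exact_mod_cast hk)
  rw [Real.exp_neg] at hpow
  rw [div_mul_eq_mul_div, le_div_iff₀ (by linarith)]
  rcases le_total (G.optA k) (G.optN k) with h | h
  · nlinarith
  · -- `OPT_A - OPT_N - OPT_N ≤ e⁻¹ * (OPT_A - OPT_N)`, multiplied by `e`
    have h1 : G.optA k - G.optN k - G.optN k ≤ (Real.exp 1)⁻¹ * (G.optA k - G.optN k) := by
      have := mul_le_mul_of_nonneg_right hpow (sub_nonneg.2 h)
      linarith
    have h2 := mul_le_mul_of_nonneg_left h1 (by linarith : (0 : ℝ) ≤ Real.exp 1)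
    rw [mul_inv_cancel_left₀ (by linarith)] at h2
    nlinarith

theorem IsInArborescence.optN_pos {G : InfluenceGraph V} (hG : G.IsInArborescence) {k : ℕ}
    (hk : 1 ≤ k) : 0 < G.optN k := by
  obtain ⟨v⟩ := hG.2.1.connected.nonempty
  have h1 : G.spread {v} ≤ G.optN k := G.spread_le_optN (by simpa using hk)
  have h2 : (1 : ℝ) ≤ G.spread {v} := by
    rw [← G.expect_const 1]
    refine G.expect_mono fun L _ => ?_
    exact_mod_cast Finset.card_pos.2 ⟨v, mem_reach.2 ⟨v, by simp, .refl⟩⟩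
  linarith

end

end InfluenceGraph

theorem mainTheorem1 :
    InfluenceGraph.adaptivityGap.{u} (fun _ G => G.IsInArborescence) ≤
      ENNReal.ofReal (2 * Real.exp 1 / (Real.exp 1 - 1)) := by
  refine iSup_le fun V => iSup_le fun _ => iSup_le fun G => iSup_le fun hG => iSup_le fun k =>
    iSup_le fun hk => ?_
  rw [← ENNReal.ofReal_div_of_pos (hG.optN_pos hk)]
  exact ENNReal.ofReal_le_ofReal ((div_le_iff₀ (hG.optN_pos hk)).2 (hG.optA_le hk))
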